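/- Let $\mathbb{F}$ be a field. An algebra is an $\mathbb{F}$-vector space with a bilinear multiplication (not assumed associative or unital), and morphisms of algebras are linear maps preserving the multiplication. A variety is the class of all algebras satisfying a given set of non-associative polynomial identities, viewed as a full subcategory of the category of algebras. A variety is *operadic* if it is determined by a set of multilinear identities, and *quadratic* if it is determined by a set of identities each of which is homogeneous of degree $2$ or homogeneous of degree $3$. A variety $\mathcal{V}$ is *action accessible* if for every object $X$ of $\mathcal{V}$, every split extension in $\mathcal{V}$ with kernel $X$ admits a morphism, in the category $\mathbf{SplExt}(X)$ of split extensions with kernel $X$ (whose morphisms are the morphisms of split extensions that are the identity on $X$), to a faithful one, i.e. to a subterminal object of $\mathbf{SplExt}(X)$. Consider the following varieties: $\mathbf{AbAlg}$ ($xy=0$); $\mathbf{Com}$ ($xy=yx$); $\mathbf{ACom}$ ($xy=-yx$); $\mathbf{CAssoc}$ ($xy=yx$ and $x(yz)=(xy)z$); $\mathbf{JJord}$ ($xy=yx$ and $x(yz)+y(zx)+z(xy)=0$); $\mathbf{Lie}$ ($xy=-yx$ and $x(yz)+y(zx)+z(xy)=0$); $\mathbf{ACAAssoc}$ ($xy=-yx$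 and $x(yz)=-(xy)z$); and $\mathbf{Nil}_2(\mathbf{Com})$, $\mathbf{Nil}_2(\mathbf{ACom})$, the subvarieties of $\mathbf{Com}$ and of $\mathbf{ACom}$ given by $(xy)z=0$ and $x(yz)=0$. **Corollary.** Let $\mathcal{V}$ be an action accessible, operadic, quadratic variety of algebras over $\mathbb{F}$, and suppose that $\mathcal{V}\neq\mathbf{AbAlg}$. 1. If $\mathcal{V}$ is commutative, i.e. $\mathcal{V}\subseteq\mathbf{Com}$, then $\mathcal{V}$ is one of $\mathbf{JJord}$, $\mathbf{CAssoc}$, $\mathbf{JJord}\cap\mathbf{CAssoc}$, $\mathbf{Nil}_2(\mathbf{Com})$. 2. If $\mathcal{V}$ is anti-commutative, i.e. $\mathcal{V}\subseteq\mathbf{ACom}$, then $\mathcal{V}$ is one of $\mathbf{Lie}$, $\mathbf{ACAAssoc}$, $\mathbf{Lie}\cap\mathbf{ACAAssoc}$, $\mathbf{Nil}_2(\mathbf{ACom})$. -/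

import Mathlib

open CategoryTheory CategoryTheory.Limits

universe u

/-! ### Action accessibility -/

section ActionAccessibility

universe v w

/-- A split extension with kernel `X` in a category with zero morphisms: a split epimorphism
`p : A ⟶ B` with a chosen section `s` and a kernel `k : X ⟶ A` of `p`. -/
structure SplitExt {C : Type w} [Category.{v} C] [HasZeroMorphisms C] (X : C) where
  A : C
  B : C
  k : X ⟶ A
  p : A ⟶ B
  s : B ⟶ A
  s_p : s ≫ p = 𝟙 B
  k_p : k ≫ p = 0
  isKernel : Nonempty (IsLimit (KernelFork.ofι k k_p))

namespace SplitExt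

variable {C : Type w} [Category.{v} C] [HasZeroMorphisms C] {X : C}

/-- A morphism of split extensions which is the identity on the kernel `X`. -/
@[ext]
structure Hom (E E' : SplitExt X) where
  a : E.A ⟶ E'.A
  b : E.B ⟶ E'.B
  k_a : E.k ≫ a = E'.k
  p_b : E.p ≫ b = a ≫ E'.p
  s_a : E.s ≫ a = b ≫ E'.s

/-- The category of split extensions with kernel `X`. -/
instance : Category (SplitExt X) where
  Hom E E' := Hom E E'
  id E := ⟨𝟙 _, 𝟙 _, by simp, by simp, by simp⟩
  comp {E E' E''} f g := ⟨f.a ≫ g.a, f.b ≫ g.b,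
    by rw [← Category.assoc, f.k_a, g.k_a],
    by rw [← Category.assoc, f.p_b, Category.assoc, g.p_b, Category.assoc],
    by rw [← Category.assoc, f.s_a, Category.assoc, g.s_a, Category.assoc]⟩
  id_comp f := Hom.ext (Category.id_comp f.a) (Category.id_comp f.b)
  comp_id f := Hom.ext (Category.comp_id f.a) (Category.comp_id f.b)
  assoc f g h := Hom.ext (Category.assoc f.a g.a h.a) (Category.assoc f.b g.b h.b)

end SplitExt

/-- A category is action accessible if, for every object `X`, every split extension with kernel
`X` admits a morphism to a faithful one, that is, to a subterminal object of the category of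
split extensions with kernel `X`. -/
def ActionAccessible (C : Type w) [Category.{v} C] [HasZeroMorphisms C] : Prop :=
  ∀ (X : C) (E : SplitExt X), ∃ E' : SplitExt X, IsSubterminal E' ∧ Nonempty (E ⟶ E')

end ActionAccessibility

/-! ### The category of non-associative algebras over a field -/

/-- A non-associative algebra over `F`: a vector space with a bilinear multiplication, which is
not assumed to be associative or to have a unit. -/
structure NAAlg (F : Type u) [Field F] where
  carrier : Type u
  [isRing : NonUnitalNonAssocRing carrier]
  [isModule : Module F carrier]
  [isScalarTower : IsScalarTower F carrier carrier]
  [smulCommClass : SMulCommClass F carrier carrier]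

namespace NAAlg

attribute [instance] NAAlg.isRing NAAlg.isModule NAAlg.isScalarTower NAAlg.smulCommClass

variable {F : Type u} [Field F]

instance : CoeSort (NAAlg F) (Type u) := ⟨NAAlg.carrier⟩

/-- A morphism of algebras: a linear map which preserves the multiplication. -/
@[ext]
structure Hom (A B : NAAlg F) where
  hom : A →ₙₐ[F] B

instance : Category (NAAlg F) where
  Hom A B := Hom A B
  id A := ⟨NonUnitalAlgHom.id F A⟩
  comp f g := ⟨g.hom.comp f.hom⟩

instance : HasZeroMorphisms (NAAlg F) where
  zero _ _ := ⟨⟨0⟩⟩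
  comp_zero _ _ := rfl
  zero_comp _ _ _ f := Hom.ext (NonUnitalAlgHom.ext fun _ => map_zero f.hom)

end NAAlg

/-! ### Identities and varieties

A non-associative polynomial on `S` is an element of `FreeNonUnitalNonAssocAlgebra F S`, the
magma algebra over `F` of the free magma on `S`. -/

namespace NAVariety

/-- The multiset of the variables that appear in a non-associative word. -/
def vars {S : Type u} : FreeMagma S → Multiset S
  | FreeMagma.of x => {x}
  | FreeMagma.mul a b => vars a + vars b

variable {F : Type u} [Field F]

/-- A polynomial is multilinear if there is one finite set `s` of variables such that in each of
its monomials every element of `s` appears exactly once and no other variable appears. -/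
def IsMultilinear {S : Type u} (φ : FreeNonUnitalNonAssocAlgebra F S) : Prop :=
  ∃ s : Finset S, ∀ w ∈ φ.coeff.support, vars w = s.val

/-- All monomials of the polynomial have degree `d`. -/
def HasDegree {S : Type u} (φ : FreeNonUnitalNonAssocAlgebra F S) (d : ℕ) : Prop :=
  ∀ w ∈ φ.coeff.support, w.length = d

/-- The algebra `A` satisfies the identity `φ`: all values of `φ` in `A` vanish. -/
def Satisfies (A : NAAlg F) {S : Type u} (φ : FreeNonUnitalNonAssocAlgebra F S) : Prop :=
  ∀ v : S → A, FreeNonUnitalNonAssocAlgebra.lift F v φ = 0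

/-- The variety of algebras determined by a set of identities. -/
def ofIdentities {S : Type u} (I : Set (FreeNonUnitalNonAssocAlgebra F S)) :
    ObjectProperty (NAAlg F) :=
  fun A => ∀ φ ∈ I, Satisfies A φ

/-- A class of algebras is an operadic variety if it is determined by a set of multilinear
identities. -/
def IsOperadic (V : ObjectProperty (NAAlg F)) : Prop :=
  ∃ (S : Type u) (I : Set (FreeNonUnitalNonAssocAlgebra F S)),
    (∀ φ ∈ I, IsMultilinear φ) ∧ V = ofIdentities I

/-- A variety is quadratic if it is determined by a set of identities, each of which is
homogeneous of degree two or homogeneous of degree three. -/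
def IsQuadratic (V : ObjectProperty (NAAlg F)) : Prop :=
  ∃ (S : Type u) (I : Set (FreeNonUnitalNonAssocAlgebra F S)),
    (∀ φ ∈ I, HasDegree φ 2 ∨ HasDegree φ 3) ∧ V = ofIdentities I

variable (F)

/-- Abelian algebras: `xy = 0`. -/
def AbAlg : ObjectProperty (NAAlg F) := fun A => ∀ x y : A, x * y = 0

/-- Commutative algebras: `xy = yx`. -/
def Com : ObjectProperty (NAAlg F) := fun A => ∀ x y : A, x * y = y * x

/-- Anti-commutative algebras: `xy = -yx`. -/
def ACom : ObjectProperty (NAAlg F) := fun A => ∀ x y : A, x * y = -(y * x)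

/-- Associative algebras: `x(yz) = (xy)z`. -/
def Assoc : ObjectProperty (NAAlg F) := fun A => ∀ x y z : A, x * (y * z) = (x * y) * z

/-- Anti-associative algebras: `x(yz) = -(xy)z`. -/
def AAssoc : ObjectProperty (NAAlg F) := fun A => ∀ x y z : A, x * (y * z) = -((x * y) * z)

/-- The Jacobi identity `x(yz) + y(zx) + z(xy) = 0`. -/
def Jacobi : ObjectProperty (NAAlg F) :=
  fun A => ∀ x y z : A, x * (y * z) + y * (z * x) + z * (x * y) = 0

/-- Commutative associative algebras. -/
def CAssoc : ObjectProperty (NAAlg F) := Com F ⊓ Assoc F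

/-- Anti-commutative anti-associative algebras. -/
def ACAAssoc : ObjectProperty (NAAlg F) := ACom F ⊓ AAssoc F

/-- Lie algebras: anti-commutativity and the Jacobi identity. -/
def Lie : ObjectProperty (NAAlg F) := ACom F ⊓ Jacobi F

/-- Jacobi--Jordan algebras: commutativity and the Jacobi identity. -/
def JJord : ObjectProperty (NAAlg F) := Com F ⊓ Jacobi F

variable {F}

/-- Two-step nilpotent algebras in `V`: those in which moreover `(xy)z = 0` and `x(yz) = 0`. -/
def Nil₂ (V : ObjectProperty (NAAlg F)) : ObjectProperty (NAAlg F) :=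
  fun A => V A ∧ ∀ x y z : A, (x * y) * z = 0 ∧ x * (y * z) = 0

end NAVariety

/-! Tensoring an algebra `A` with `tF[t]/(t⁴)` kills all identities of degree greater than three,
and `A` satisfies every identity of degree two or three of the resulting algebra. Hence a variety
that is both operadic and quadratic is determined by its multilinear identities of degree at most
three.

For a variety that contains the abelian algebras and some other one, and in which `xy = ε yx`
with `ε = ±1`, these are, modulo `xy = ε yx`, the identities `α x(yz) + β y(zx) + γ z(xy) = 0` with
`(α, β, γ)` in some subspace of `F³`. A transposition of the variables permutes the coordinates, up
to the sign `ε`, so the subspace is stable under permutations. The stable subspaces are `0`, the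
diagonal, the plane `α + β + γ = 0` and `F³`. They give the varieties defined by no further
identity, by the Jacobi identity, by (anti-)associativity and by two-step nilpotency. (The
intersection in the statement is therefore one of the others: if `3 ≠ 0` in `F` it is two-step
nilpotent, and otherwise (anti-)associativity implies the Jacobi identity.)

The first of the four is not action accessible. There every bilinear map `A × N → N` is an action
of `A` on the abelian algebra `N`, while in a faithful split extension the elements that act
trivially form an ideal. -/

/-- A submodule of `ι → R` is swap-invariant if it is stable under every transposition of the
coordinates, hence under all permutations when `ι` is finite. -/
def SwapInvariant {R ι : Type*} [Semiring R] [DecidableEq ι] (W : Submodule R (ι → R)) : Prop :=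
  ∀ c ∈ W, ∀ i j : ι, c ∘ Equiv.swap i j ∈ W

namespace SwapInvariant

variable {K ι : Type*} [DivisionRing K] [DecidableEq ι] {W : Submodule K (ι → K)}

theorem single_sub_single_mem_of_ne (hW : SwapInvariant W) {c : ι → K} (hc : c ∈ W) {i j : ι}
    (hij : c i ≠ c j) : Pi.single i 1 - Pi.single j 1 ∈ W := by
  have hdiff : c - c ∘ Equiv.swap i j = (c i - c j) • (Pi.single i 1 - Pi.single j 1) := by
    ext k
    have : i ≠ j := ne_of_apply_ne c hij
    rcases eq_or_ne k i with rfl | hki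
    · simp [this]
    rcases eq_or_ne k j with rfl | hkj
    · simp [hki]
    · simp [hki, hkj, Equiv.swap_apply_of_ne_of_ne hki hkj]
  have hmem := hdiff ▸ W.sub_mem hc (hW c hc i j)
  exact (W.smul_mem_iff (sub_ne_zero.mpr hij)).mp hmem

theorem single_sub_single_mem (hW : SwapInvariant W) {i j : ι} (hij : i ≠ j)
    (h : Pi.single i 1 - Pi.single j 1 ∈ W) (k : ι) : Pi.single k 1 - Pi.single i 1 ∈ W := by
  rcases eq_or_ne k i with rfl | hki
  · simp
  have hswap : (Pi.single i 1 - Pi.single j 1 : ι → K) ∘ Equiv.swap j k =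
      Pi.single i 1 - Pi.single k 1 := by
    rw [Pi.sub_comp, Pi.single_comp_equiv, Pi.single_comp_equiv]
    simp [Equiv.swap_apply_of_ne_of_ne hij hki.symm]
  have hik : Pi.single i 1 - Pi.single k 1 ∈ W := hswap ▸ hW _ h j k
  simpa using W.neg_mem hik

variable [Fintype ι]

theorem ker_sum_le (hW : SwapInvariant W) {c : ι → K} (hc : c ∈ W) {i j : ι} (hij : c i ≠ c j) :
    LinearMap.ker (∑ k, LinearMap.proj k : (ι → K) →ₗ[K] K) ≤ W := by
  have hmem := hW.single_sub_single_mem (ne_of_apply_ne c hij)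
    (hW.single_sub_single_mem_of_ne hc hij)
  intro d hd
  have hsum : ∑ k, d k = 0 := by simpa using hd
  have hd' : d = ∑ k, d k • (Pi.single k 1 - Pi.single i 1) := by
    simp_rw [smul_sub, Finset.sum_sub_distrib, ← Finset.sum_smul, hsum, zero_smul, sub_zero]
    exact pi_eq_sum_univ' d
  rw [hd']
  exact W.sum_mem fun k _ => W.smul_mem _ (hmem k)

theorem eq_bot_or_eq_span_or_eq_ker_or_eq_top (hW : SwapInvariant W) :
    W = ⊥ ∨ W = Submodule.span K {1} ∨
      W = LinearMap.ker (∑ k, LinearMap.proj k : (ι → K) →ₗ[K] K) ∨ W = ⊤ := by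
  by_cases hconst : ∀ c ∈ W, ∀ i j, c i = c j
  · rcases eq_or_ne W ⊥ with hbot | hbot
    · exact .inl hbot
    obtain ⟨c, hc, hc0⟩ := W.exists_mem_ne_zero_of_ne_bot hbot
    obtain ⟨i, hi⟩ := Function.ne_iff.mp hc0
    have hsmul : ∀ d ∈ W, d = d i • (1 : ι → K) := fun d hd =>
      funext fun j => by simp [hconst d hd j i]
    refine .inr (.inl (le_antisymm (fun d hd => ?_) ?_))
    · exact Submodule.mem_span_singleton.mpr ⟨d i, (hsmul d hd).symm⟩
    · rw [Submodule.span_singleton_le_iff_mem]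
      exact (W.smul_mem_iff hi).mp (hsmul c hc ▸ hc)
  · push Not at hconst
    obtain ⟨c, hc, i, j, hij⟩ := hconst
    have hsurj : Function.Surjective (∑ k, LinearMap.proj k : (ι → K) →ₗ[K] K) := fun a =>
      ⟨Pi.single i a, by simp⟩
    have hcoatom := LinearMap.isCoatom_ker_of_surjective hsurj
    exact .inr (.inr ((hcoatom.le_iff.mp (hW.ker_sum_le hc hij)).symm))

end SwapInvariant

namespace NAAlg

variable {F : Type u} [Field F]

/-- A multiplicative linear map as a morphism of algebras. -/
def homOfLinear {A B : NAAlg F} (f : A →ₗ[F] B) (hf : ∀ x y, f (x * y) = f x * f y) : A ⟶ B :=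
  ⟨{ f with map_zero' := map_zero f, map_mul' := hf }⟩

theorem fullSubcategory_hom_ext {V : ObjectProperty (NAAlg F)} {A B : V.FullSubcategory}
    {f g : A ⟶ B} (h : ∀ x, f.hom.hom x = g.hom.hom x) : f = g :=
  InducedCategory.hom_ext (NAAlg.Hom.ext (NonUnitalAlgHom.ext h))

section OfBilin

variable {M : Type u} [AddCommGroup M] [Module F M]

/-- The algebra on a vector space `M` whose multiplication is a given bilinear map. Its elements
are related to those of `M` by `ofBilin.equiv`, since `M` may carry another multiplication. -/
def ofBilin (μ : M →ₗ[F] M →ₗ[F] M) : NAAlg F :=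
  letI : NonUnitalNonAssocRing M :=
    { (inferInstance : AddCommGroup M) with
      mul := fun x y => μ x y
      left_distrib := fun x => map_add (μ x)
      right_distrib := μ.map_add₂
      zero_mul := μ.map_zero₂
      mul_zero := fun x => map_zero (μ x) }
  { carrier := M
    isScalarTower := ⟨μ.map_smul₂⟩
    smulCommClass := ⟨fun a x y => ((μ x).map_smul a y).symm⟩ }

/-- The elements of `ofBilin μ` as elements of the underlying vector space. -/
def ofBilin.equiv (μ : M →ₗ[F] M →ₗ[F] M) : ofBilin μ ≃ₗ[F] M := LinearEquiv.refl F M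

variable (F M) in
/-- The vector space `M` with the zero multiplication. -/
def abelian : NAAlg F := ofBilin (0 : M →ₗ[F] M →ₗ[F] M)

variable (F M) in
/-- The elements of `abelian F M` as elements of `M`. -/
def abelian.equiv : abelian F M ≃ₗ[F] M := ofBilin.equiv 0

theorem abelian_mul (x y : abelian F M) : x * y = 0 := rfl

end OfBilin

/-- The morphism from the abelian line that sends `1` to an element `a` with `a * a = 0`. -/
def ofSquareZero {A : NAAlg F} (a : A) (ha : a * a = 0) : abelian F F ⟶ A :=
  homOfLinear (LinearMap.toSpanSingleton F A a ∘ₗ (abelian.equiv F F).toLinearMap) fun x y => by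
    simp [abelian_mul, smul_mul_smul_comm, ha]

/-! ### Semidirect products -/

section Semidirect

variable {A : NAAlg F} {N : Type u} [AddCommGroup N] [Module F N]

/-- The multiplication of the semidirect product of `A` and `N`, see `NAAlg.semidirect`. -/
def semidirectMul (ε : F) (ρ : A →ₗ[F] N →ₗ[F] N) : A × N →ₗ[F] A × N →ₗ[F] A × N :=
  LinearMap.mk₂ F (fun p q => (p.1 * q.1, ρ p.1 q.2 + ε • ρ q.1 p.2))
    (fun p q r => by ext <;> simp [add_mul, add_add_add_comm])
    (fun c p q => by ext <;> simp [smul_mul_assoc, smul_comm c ε])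
    (fun p q r => by ext <;> simp [mul_add, add_add_add_comm])
    (fun c p q => by ext <;> simp [mul_smul_comm, smul_comm c ε])

/-- The semidirect product of an algebra `A` and a vector space `N` with zero multiplication, on
which `A` acts on the left through `ρ` and on the right through `ε • ρ`. -/
def semidirect (ε : F) (ρ : A →ₗ[F] N →ₗ[F] N) : NAAlg F := ofBilin (semidirectMul ε ρ)

namespace semidirect

variable (ε : F) (ρ : A →ₗ[F] N →ₗ[F] N)

/-- The elements of the semidirect product as pairs. -/
def equiv : semidirect ε ρ ≃ₗ[F] A × N := ofBilin.equiv _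

@[simp] theorem equiv_mul (x y : semidirect ε ρ) : equiv ε ρ (x * y) =
    ((equiv ε ρ x).1 * (equiv ε ρ y).1,
      ρ (equiv ε ρ x).1 (equiv ε ρ y).2 + ε • ρ (equiv ε ρ y).1 (equiv ε ρ x).2) := rfl

/-- The inclusion of the acting algebra. -/
def inl : A ⟶ semidirect ε ρ :=
  homOfLinear ((equiv ε ρ).symm.toLinearMap ∘ₗ LinearMap.inl F A N) fun x y =>
    (equiv ε ρ).injective (by simp)

/-- The inclusion of the ideal that is acted upon. -/
def inr : abelian F N ⟶ semidirect ε ρ :=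
  homOfLinear ((equiv ε ρ).symm.toLinearMap ∘ₗ LinearMap.inr F A N ∘ₗ
    (abelian.equiv F N).toLinearMap) fun x y => (equiv ε ρ).injective (by simp [abelian_mul])

/-- The projection to the acting algebra. -/
def fst : semidirect ε ρ ⟶ A :=
  homOfLinear (LinearMap.fst F A N ∘ₗ (equiv ε ρ).toLinearMap) fun x y => by simp

@[simp] theorem equiv_inl (a : A) : equiv ε ρ ((inl ε ρ).hom a) = (a, 0) := rfl

@[simp] theorem equiv_inr (n : abelian F N) :
    equiv ε ρ ((inr ε ρ).hom n) = (0, abelian.equiv F N n) := rfl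

theorem inl_mul_inr (a : A) (n : abelian F N) : (inl ε ρ).hom a * (inr ε ρ).hom n =
    (inr ε ρ).hom ((abelian.equiv F N).symm (ρ a (abelian.equiv F N n))) :=
  (equiv ε ρ).injective (by simp)

variable {ρ} in
/-- The projection to the ideal, which is multiplicative when the action is trivial. -/
def sndOfEqZero (hρ : ρ = 0) : semidirect ε ρ ⟶ abelian F N :=
  homOfLinear ((abelian.equiv F N).symm.toLinearMap ∘ₗ LinearMap.snd F A N ∘ₗ
    (equiv ε ρ).toLinearMap) fun x y => by simp [hρ, abelian_mul]

/-- The factorization through `inr` of a morphism whose first component vanishes. -/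
def liftInr {B : NAAlg F} (g : B ⟶ semidirect ε ρ) (hg : ∀ b, (equiv ε ρ (g.hom b)).1 = 0) :
    B ⟶ abelian F N :=
  homOfLinear ((abelian.equiv F N).symm.toLinearMap ∘ₗ LinearMap.snd F A N ∘ₗ
    (equiv ε ρ).toLinearMap ∘ₗ (g.hom : B →ₗ[F] semidirect ε ρ)) fun x y => by
      simp [hg, abelian_mul]

/-- Pulling back the action along a morphism of the acting algebras. -/
def map {D : NAAlg F} (φ : D ⟶ A) :
    semidirect ε (ρ ∘ₗ (φ.hom : D →ₗ[F] A)) ⟶ semidirect ε ρ :=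
  homOfLinear ((equiv ε ρ).symm.toLinearMap ∘ₗ
    LinearMap.prodMap (φ.hom : D →ₗ[F] A) LinearMap.id ∘ₗ (equiv ε _).toLinearMap) fun x y =>
      (equiv ε ρ).injective (by simp)

end semidirect

end Semidirect

/-! ### Truncations -/

section Trunc

variable (A : NAAlg F)

/-- The multiplication of `NAAlg.trunc`, in coordinates with respect to `t, t², t³`. -/
def truncMul : A × A × A →ₗ[F] A × A × A →ₗ[F] A × A × A :=
  LinearMap.mk₂ F (fun x y => (0, x.1 * y.1, x.1 * y.2.1 + x.2.1 * y.1))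
    (fun x y z => by ext <;> simp [add_mul, add_add_add_comm])
    (fun c x y => by ext <;> simp [smul_mul_assoc])
    (fun x y z => by ext <;> simp [mul_add, add_add_add_comm])
    (fun c x y => by ext <;> simp [mul_smul_comm])

/-- The truncation `A ⊗ tF[t]/(t⁴)` of `A`. It satisfies all identities of degree greater than
three, but remembers the homogeneous identities of `A` of degree two and three. -/
def trunc : NAAlg F := ofBilin (truncMul A)

variable {A}

/-- The coefficients of `t`, `t²` and `t³` of an element of the truncation. -/
def trunc.coords : trunc A ≃ₗ[F] A × A × A := ofBilin.equiv _

@[simp] theorem trunc.coords_mul (x y : trunc A) : coords (x * y) =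
    (0, (coords x).1 * (coords y).1,
      (coords x).1 * (coords y).2.1 + (coords x).2.1 * (coords y).1) := rfl

end Trunc

end NAAlg

namespace SplitExt

variable {C : Type*} [Category* C] [HasZeroMorphisms C] {X : C}

theorem mono_k (E : SplitExt X) : Mono E.k :=
  mono_of_isLimit_fork E.isKernel.some

/-- The idea is that `T` also maps to `E'` through its retraction onto the kernel, by a morphism
that vanishes on the base. -/
theorem b_comp_b_eq_zero_of_isSubterminal {T E E' : SplitExt X} (hE' : IsSubterminal E')
    (g : T ⟶ E) (f : E ⟶ E') (r : T.A ⟶ X) (hk : T.k ≫ r = 𝟙 X) (hs : T.s ≫ r = 0) :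
    g.b ≫ f.b = 0 := by
  let z : T ⟶ E' :=
    { a := r ≫ E'.k
      b := 0
      k_a := by rw [← Category.assoc, hk, Category.id_comp]
      p_b := by rw [Category.assoc, E'.k_p, comp_zero, comp_zero]
      s_a := by rw [← Category.assoc, hs, zero_comp, zero_comp] }
  exact congrArg Hom.b (IsSubterminal.def.mp hE' (g ≫ f) z)

end SplitExt

namespace NAVariety

open NAAlg FreeNonUnitalNonAssocAlgebra
open MonoidAlgebra (ofMagma)

variable {F S : Type u} [Field F]

/-- The algebras that satisfy `x * y = ε • (y * x)`. The cases `ε = 1` and `ε = -1` are the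
commutative and the anti-commutative algebras. -/
def SignedCom (ε : F) : ObjectProperty (NAAlg F) := fun A => ∀ x y : A, x * y = ε • (y * x)

theorem signedCom_one : SignedCom (1 : F) = Com F := by
  funext A
  simp only [SignedCom, Com, one_smul]

theorem signedCom_neg_one : SignedCom (-1 : F) = ACom F := by
  funext A
  simp only [SignedCom, ACom, neg_smul, one_smul]

section ScalarExtensions

variable {ε : F} {A : NAAlg F} {N : Type u} [AddCommGroup N] [Module F N]

theorem SignedCom.abelian (ε : F) (N : Type u) [AddCommGroup N] [Module F N] :
    SignedCom ε (abelian F N) := fun x y => by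
  rw [abelian_mul, abelian_mul, smul_zero]

theorem SignedCom.semidirect (hε : ε * ε = 1) (hA : SignedCom ε A) (ρ : A →ₗ[F] N →ₗ[F] N) :
    SignedCom ε (semidirect ε ρ) := fun x y => by
  apply (semidirect.equiv ε ρ).injective
  rw [map_smul, semidirect.equiv_mul, semidirect.equiv_mul, Prod.smul_mk, ← hA, smul_add,
    smul_smul, hε, one_smul, add_comm]

/-- The object of `SignedCom ε` given by the zero multiplication on a vector space. -/
abbrev abelianObj (ε : F) (N : Type u) [AddCommGroup N] [Module F N] :
    (SignedCom ε).FullSubcategory :=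
  ⟨abelian F N, SignedCom.abelian ε N⟩

/-- Since `SignedCom ε` imposes no condition on actions, every bilinear map `ρ` gives a split
extension of `A` with kernel `N`. -/
def semidirectExt (hε : ε * ε = 1) (hA : SignedCom ε A) (ρ : A →ₗ[F] N →ₗ[F] N) :
    SplitExt (abelianObj ε N) where
  A := ⟨semidirect ε ρ, hA.semidirect hε ρ⟩
  B := ⟨A, hA⟩
  k := ⟨semidirect.inr ε ρ⟩
  p := ⟨semidirect.fst ε ρ⟩
  s := ⟨semidirect.inl ε ρ⟩
  s_p := rfl
  k_p := rfl
  isKernel := by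
    have fst_apply_eq_zero {W : (SignedCom ε).FullSubcategory}
        {g : W ⟶ ⟨semidirect ε ρ, hA.semidirect hε ρ⟩}
        (hg : g ≫ (⟨semidirect.fst ε ρ⟩ : _ ⟶ (⟨A, hA⟩ : (SignedCom ε).FullSubcategory)) = 0)
        (w : W.obj) : (semidirect.equiv ε ρ (g.hom.hom w)).1 = 0 :=
      congrArg (fun f => f.hom.hom w) hg
    refine ⟨KernelFork.IsLimit.ofι _ _ (fun g hg => ⟨semidirect.liftInr ε ρ g.hom
      (fst_apply_eq_zero hg)⟩) (fun g hg => ?_) (fun g hg m hm => ?_)⟩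
    · refine fullSubcategory_hom_ext fun w => ?_
      exact (semidirect.equiv ε ρ).injective (Prod.ext (fst_apply_eq_zero hg w).symm rfl)
    · subst hm
      rfl

/-- The morphism of split extensions from the pullback of the action along `φ`. -/
def semidirectExtMap {D : NAAlg F} (hε : ε * ε = 1) (hD : SignedCom ε D) (hA : SignedCom ε A)
    (φ : D ⟶ A) (ρ : A →ₗ[F] N →ₗ[F] N) :
    semidirectExt hε hD (ρ ∘ₗ (φ.hom : D →ₗ[F] A)) ⟶ semidirectExt hε hA ρ where
  a := ⟨semidirect.map ε ρ φ⟩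
  b := ⟨φ⟩
  k_a := fullSubcategory_hom_ext fun _ =>
    (semidirect.equiv ε ρ).injective (Prod.ext (map_zero φ.hom) rfl)
  p_b := rfl
  s_a := rfl

theorem eq_zero_of_mono {B : (SignedCom ε).FullSubcategory} (k : abelianObj ε N ⟶ B) [Mono k]
    {n : abelian F N} (hn : k.hom.hom n = 0) : n = 0 := by
  let g : abelianObj ε F ⟶ abelianObj ε N := ⟨ofSquareZero n (abelian_mul n n)⟩
  have hg : g = 0 := by
    rw [← cancel_mono k, zero_comp]
    refine fullSubcategory_hom_ext fun t => ?_
    change k.hom.hom (abelian.equiv F F t • n) = 0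
    rw [map_smul, hn, smul_zero]
  have h1 := congrArg (fun f => f.hom.hom ((abelian.equiv F F).symm 1)) hg
  exact (one_smul F n).symm.trans h1

theorem base_eq_zero_of_isSubterminal {hε : ε * ε = 1} {hA : SignedCom ε A}
    {ρ : A →ₗ[F] N →ₗ[F] N} {E : SplitExt (abelianObj ε N)} (hE : IsSubterminal E)
    (f : semidirectExt hε hA ρ ⟶ E) {a : A} (ha : a * a = 0) (hρ : ρ a = 0) :
    f.b.hom.hom a = 0 := by
  let φ := ofSquareZero a ha
  have hρφ : ρ ∘ₗ (φ.hom : abelian F F →ₗ[F] A) = 0 := LinearMap.ext fun t => by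
    change ρ (abelian.equiv F F t • a) = 0
    rw [map_smul, hρ, smul_zero]
  have hφf : (semidirectExtMap hε (SignedCom.abelian ε F) hA φ ρ).b ≫ f.b = 0 :=
    SplitExt.b_comp_b_eq_zero_of_isSubterminal hE _ f ⟨semidirect.sndOfEqZero ε hρφ⟩ rfl rfl
  have hφf_one := congrArg (fun g => g.hom.hom ((abelian.equiv F F).symm 1)) hφf
  exact (congrArg f.b.hom.hom (one_smul F a).symm).trans hφf_one

theorem action_eq_zero_of_base_eq_zero {hε : ε * ε = 1} {hA : SignedCom ε A}
    {ρ : A →ₗ[F] N →ₗ[F] N} {E : SplitExt (abelianObj ε N)} (f : semidirectExt hε hA ρ ⟶ E)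
    {a : A} (ha : f.b.hom.hom a = 0) : ρ a = 0 := by
  let α : semidirect ε ρ →ₙₐ[F] E.A.obj := f.a.hom.hom
  have α_inl : α ((semidirect.inl ε ρ).hom a) = 0 :=
    (congrArg (fun g => g.hom.hom a) f.s_a).trans
      ((congrArg E.s.hom.hom ha).trans (map_zero E.s.hom.hom))
  have α_inr (n : abelian F N) : α ((semidirect.inr ε ρ).hom n) = E.k.hom.hom n :=
    congrArg (fun g => g.hom.hom n) f.k_a
  have := E.mono_k
  refine LinearMap.ext fun n => (abelian.equiv F N).symm.injective ?_
  refine (eq_zero_of_mono E.k ?_).trans (map_zero (abelian.equiv F N).symm).symm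
  calc E.k.hom.hom ((abelian.equiv F N).symm (ρ a n))
      = α ((semidirect.inl ε ρ).hom a * (semidirect.inr ε ρ).hom ((abelian.equiv F N).symm n)) := by
        rw [semidirect.inl_mul_inr, LinearEquiv.apply_symm_apply, α_inr]
    _ = 0 := by rw [map_mul, α_inl, zero_mul]

/-- The elements that act trivially on `N` have to form an ideal. -/
theorem action_mul_eq_zero_of_actionAccessible
    (h : ActionAccessible (SignedCom ε).FullSubcategory) (hε : ε * ε = 1) (hA : SignedCom ε A)
    (ρ : A →ₗ[F] N →ₗ[F] N) {a : A} (ha : a * a = 0) (hρ : ρ a = 0) (b : A) :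
    ρ (a * b) = 0 := by
  obtain ⟨E, hE, ⟨f⟩⟩ := h (abelianObj ε N) (semidirectExt hε hA ρ)
  let β : A →ₙₐ[F] E.B.obj := f.b.hom.hom
  have hβa : β a = 0 := base_eq_zero_of_isSubterminal hE f ha hρ
  have hβab : β (a * b) = 0 := by rw [map_mul, hβa, zero_mul]
  exact action_eq_zero_of_base_eq_zero f hβab

/-- The witness is the algebra with basis `a, c` and products `a c = c`, `c a = ε c`, acting on
the line in such a way that `a` acts as zero and `c = a c` as the identity. -/
theorem not_actionAccessible_signedCom (hε : ε * ε = 1) :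
    ¬ ActionAccessible (SignedCom ε).FullSubcategory := by
  intro h
  let act : abelian F F →ₗ[F] F →ₗ[F] F :=
    LinearMap.lsmul F F ∘ₗ (abelian.equiv F F).toLinearMap
  let ρ : semidirect ε act →ₗ[F] F →ₗ[F] F :=
    LinearMap.lsmul F F ∘ₗ LinearMap.snd F _ F ∘ₗ (semidirect.equiv ε act).toLinearMap
  let one : abelian F F := (abelian.equiv F F).symm 1
  let a := (semidirect.inl ε act).hom one
  let c := (semidirect.inr ε act).hom one
  have ha : a * a = 0 := by rw [← map_mul, abelian_mul, map_zero]
  have hac : a * c = c := by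
    simp [a, c, one, act, semidirect.inl_mul_inr]
  have hρa : ρ a = 0 := by simp [ρ, a]
  have hρc : ρ (a * c) = 0 := action_mul_eq_zero_of_actionAccessible h hε
    ((SignedCom.abelian ε F).semidirect hε act) ρ ha hρa c
  rw [hac] at hρc
  have : (1 : F) = 0 := by simpa [ρ, c, one] using LinearMap.congr_fun hρc 1
  exact one_ne_zero this

end ScalarExtensions

/-! ### Words and polynomials -/

section Words

theorem card_vars (w : FreeMagma S) : (vars w).card = w.length := by
  induction w with
  | ih1 x => simp [vars, FreeMagma.length]
  | ih2 a b ha hb =>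
    change (vars a + vars b).card = a.length + b.length
    rw [Multiset.card_add, ha, hb]

theorem exists_of_length_one {w : FreeMagma S} (h : w.length = 1) : ∃ x, w = .of x := by
  cases w with
  | of x => exact ⟨x, rfl⟩
  | mul a b =>
    change a.length + b.length = 1 at h
    have := a.length_pos
    have := b.length_pos
    omega

theorem exists_of_length_two {w : FreeMagma S} (h : w.length = 2) :
    ∃ x y, w = .of x * .of y := by
  cases w with
  | of x => simp [FreeMagma.length] at h
  | mul a b =>
    change a.length + b.length = 2 at h
    have := a.length_pos
    have := b.length_pos
    obtain ⟨x, rfl⟩ := exists_of_length_one (w := a) (by omega)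
    obtain ⟨y, rfl⟩ := exists_of_length_one (w := b) (by omega)
    exact ⟨x, y, rfl⟩

theorem exists_of_length_three {w : FreeMagma S} (h : w.length = 3) :
    ∃ x y z, w = .of x * (.of y * .of z) ∨ w = (.of x * .of y) * .of z := by
  cases w with
  | of x => simp [FreeMagma.length] at h
  | mul a b =>
    change a.length + b.length = 3 at h
    have := a.length_pos
    have := b.length_pos
    obtain ha | ha : a.length = 1 ∨ a.length = 2 := by omega
    · obtain ⟨x, rfl⟩ := exists_of_length_one ha
      obtain ⟨y, z, rfl⟩ := exists_of_length_two (w := b) (by omega)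
      exact ⟨x, y, z, .inl rfl⟩
    · obtain ⟨x, y, rfl⟩ := exists_of_length_two ha
      obtain ⟨z, rfl⟩ := exists_of_length_one (w := b) (by omega)
      exact ⟨x, y, z, .inr rfl⟩

variable {φ : FreeNonUnitalNonAssocAlgebra F S}

theorem mem_of_forall_ofMagma_mem {N : Submodule F (FreeNonUnitalNonAssocAlgebra F S)}
    (h : ∀ w ∈ φ.coeff.support, ofMagma F _ w ∈ N) : φ ∈ N := by
  rw [← MonoidAlgebra.sum_coeff_single φ]
  refine N.sum_mem fun w hw => ?_
  convert N.smul_mem (φ.coeff w) (h w hw) using 1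
  simp

theorem lift_ofMagma {A : NAAlg F} (v : S → A) (w : FreeMagma S) :
    lift F v (ofMagma F _ w) = FreeMagma.lift v w := by
  induction w with
  | ih1 x => exact lift_of_apply F v x
  | ih2 a b ha hb => rw [map_mul, map_mul, map_mul, ha, hb]

theorem lift_eq_zero_of_forall {A : NAAlg F} {v : S → A}
    (h : ∀ w ∈ φ.coeff.support, FreeMagma.lift v w = 0) : lift F v φ = 0 :=
  mem_of_forall_ofMagma_mem
    (N := LinearMap.ker (lift F v : FreeNonUnitalNonAssocAlgebra F S →ₗ[F] A)) fun w hw =>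
      (lift_ofMagma v w).trans (h w hw)

theorem abAlg_le_of_isQuadratic {V : ObjectProperty (NAAlg F)} (hV : IsQuadratic V) :
    AbAlg F ≤ V := by
  obtain ⟨S, I, hI, rfl⟩ := hV
  refine fun A hA φ hφ v => lift_eq_zero_of_forall fun w hw => ?_
  have hlength : w.length ≠ 1 := by
    rcases hI φ hφ with h | h <;> rw [h w hw] <;> decide
  cases w with
  | of x => exact absurd rfl hlength
  | mul a b => exact hA _ _

end Words

/-! ### Identities of truncations -/

section Trunc

variable {A : NAAlg F} {φ : FreeNonUnitalNonAssocAlgebra F S}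

theorem coords_lift_eq_zero (v : S → trunc A) (w : FreeMagma S) :
    (1 < w.length → (trunc.coords (FreeMagma.lift v w)).1 = 0) ∧
    (2 < w.length → (trunc.coords (FreeMagma.lift v w)).2.1 = 0) ∧
    (3 < w.length → (trunc.coords (FreeMagma.lift v w)).2.2 = 0) := by
  induction w with
  | ih1 x => simp [FreeMagma.length]
  | ih2 a b ha hb =>
    have := a.length_pos
    have := b.length_pos
    change (1 < a.length + b.length → _) ∧ (2 < a.length + b.length → _) ∧
      (3 < a.length + b.length → _)
    rw [map_mul, trunc.coords_mul]
    refine ⟨fun _ => rfl, fun h => ?_, fun h => ?_⟩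
    · obtain h | h : 1 < a.length ∨ 1 < b.length := by omega
      · simp [ha.1 h]
      · simp [hb.1 h]
    · have h1 : 1 < a.length ∨ 2 < b.length := by omega
      have h2 : 2 < a.length ∨ 1 < b.length := by omega
      rcases h1 with h1 | h1 <;> rcases h2 with h2 | h2 <;>
        simp [ha.1, ha.2.1, hb.1, hb.2.1, h1, h2]

theorem satisfies_trunc_of_three_lt_length (h : ∀ w ∈ φ.coeff.support, 3 < w.length) :
    Satisfies (trunc A) φ := fun v => lift_eq_zero_of_forall fun w hw => by
  have hw := h w hw
  obtain ⟨h1, h2, h3⟩ := coords_lift_eq_zero v w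
  apply trunc.coords.injective
  exact Prod.ext (h1 (by omega)) (Prod.ext (h2 (by omega)) (h3 hw))

/-- The identity is evaluated in the truncation at multiples of `t`. -/
theorem satisfies_of_satisfies_trunc (hφ : HasDegree φ 2 ∨ HasDegree φ 3)
    (h : Satisfies (trunc A) φ) : Satisfies A φ := by
  intro v
  let f : FreeNonUnitalNonAssocAlgebra F S →ₗ[F] A := lift F v
  let u : S → trunc A := fun x => trunc.coords.symm (v x, 0, 0)
  let g : FreeNonUnitalNonAssocAlgebra F S →ₗ[F] A × A × A :=
    trunc.coords.toLinearMap ∘ₗ (lift F u : FreeNonUnitalNonAssocAlgebra F S →ₗ[F] trunc A)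
  have hg : g φ = 0 := (congrArg trunc.coords (h u)).trans (map_zero _)
  have hf_word (w) : f (ofMagma F _ w) = FreeMagma.lift v w := lift_ofMagma v w
  have hg_word (w) : g (ofMagma F _ w) = trunc.coords (FreeMagma.lift u w) :=
    congrArg trunc.coords (lift_ofMagma u w)
  rcases hφ with hφ | hφ
  · let coeffTwo : A × A × A →ₗ[F] A := LinearMap.fst F A A ∘ₗ LinearMap.snd F A (A × A)
    have hfg : f φ = coeffTwo (g φ) :=
      mem_of_forall_ofMagma_mem (N := LinearMap.eqLocus f (coeffTwo ∘ₗ g)) fun w hw => by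
        obtain ⟨x, y, rfl⟩ := exists_of_length_two (hφ w hw)
        rw [LinearMap.mem_eqLocus, LinearMap.comp_apply, hf_word, hg_word]
        simp [coeffTwo, u]
    rwa [hg, map_zero] at hfg
  · let coeffThree : A × A × A →ₗ[F] A := LinearMap.snd F A A ∘ₗ LinearMap.snd F A (A × A)
    have hfg : f φ = coeffThree (g φ) :=
      mem_of_forall_ofMagma_mem (N := LinearMap.eqLocus f (coeffThree ∘ₗ g)) fun w hw => by
        obtain ⟨x, y, z, rfl | rfl⟩ := exists_of_length_three (hφ w hw) <;>
        · rw [LinearMap.mem_eqLocus, LinearMap.comp_apply, hf_word, hg_word]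
          simp [coeffThree, u]
    rwa [hg, map_zero] at hfg

theorem SignedCom.trunc {ε : F} (hA : SignedCom ε A) : SignedCom ε (trunc A) := by
  intro x y
  apply trunc.coords.injective
  rw [map_smul]
  ext
  · simp
  · simpa using hA _ _
  · simp only [trunc.coords_mul, Prod.smul_snd, smul_add]
    rw [hA, hA (trunc.coords x).2.1, add_comm]

end Trunc

/-! ### Identities modulo (anti-)commutativity -/

section Identities

/-- The polynomials in variables from `S` that are identities of all algebras in `W`. -/
def identities (W : ObjectProperty (NAAlg F)) (S : Type u) :
    Submodule F (FreeNonUnitalNonAssocAlgebra F S) where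
  carrier := {φ | ∀ A, W A → Satisfies A φ}
  zero_mem' A _ v := map_zero (lift F v)
  add_mem' hφ hψ A hA v := by rw [map_add, hφ A hA v, hψ A hA v, add_zero]
  smul_mem' c φ hφ A hA v := by rw [map_smul, hφ A hA v, smul_zero]

theorem identities_anti {W W' : ObjectProperty (NAAlg F)} (h : W ≤ W') :
    identities W' S ≤ identities W S :=
  fun _ hφ A hA => hφ A (h A hA)

variable {ε : F}

theorem mul_sub_smul_mul_mem_identities (ε : F) (p q : FreeNonUnitalNonAssocAlgebra F S) :
    p * q - ε • (q * p) ∈ identities (SignedCom ε) S := fun A hA v => by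
  rw [map_sub, map_smul, map_mul, map_mul, hA, sub_self]

theorem mul_mem_identities {W : ObjectProperty (NAAlg F)}
    {p : FreeNonUnitalNonAssocAlgebra F S} (hp : p ∈ identities W S)
    (r : FreeNonUnitalNonAssocAlgebra F S) : r * p ∈ identities W S := fun A hA v => by
  rw [map_mul, hp A hA v, mul_zero]

section Swap

variable {N : Submodule F (FreeNonUnitalNonAssocAlgebra F S)}
  {p q r : FreeNonUnitalNonAssocAlgebra F S}

theorem mul_mem_of_mul_swap_mem (hN : identities (SignedCom ε) S ≤ N) (h : q * p ∈ N) :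
    p * q ∈ N :=
  (N.sub_mem_iff_left (N.smul_mem ε h)).mp (hN (mul_sub_smul_mul_mem_identities ε p q))

theorem mul_mul_mem_of_mul_mul_swap_mem (hN : identities (SignedCom ε) S ≤ N)
    (h : r * (q * p) ∈ N) : r * (p * q) ∈ N := by
  have hdiff := hN (mul_mem_identities (mul_sub_smul_mul_mem_identities ε p q) r)
  rw [mul_sub, mul_smul_comm] at hdiff
  exact (N.sub_mem_iff_left (N.smul_mem ε h)).mp hdiff

end Swap

section Multilinear

theorem eq_or_swap_of_pair_eq {a b x y : S} (h : ({a, b} : Multiset S) = {x, y}) :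
    (a = x ∧ b = y) ∨ (a = y ∧ b = x) := by
  have ha : a ∈ ({x, y} : Multiset S) := h ▸ Multiset.mem_cons_self a _
  simp only [Multiset.insert_eq_cons, Multiset.mem_cons, Multiset.mem_singleton] at ha
  rcases ha with rfl | rfl
  · exact .inl ⟨rfl, Multiset.singleton_inj.mp ((Multiset.cons_inj_right a).mp h)⟩
  · refine .inr ⟨rfl, Multiset.singleton_inj.mp ((Multiset.cons_inj_right a).mp ?_)⟩
    exact h.trans (Multiset.pair_comm ..)

theorem eq_or_rotate_of_triple_eq {a b c x y z : S} (h : ({a, b, c} : Multiset S) = {x, y, z}) :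
    (a = x ∧ ({b, c} : Multiset S) = {y, z}) ∨ (a = y ∧ ({b, c} : Multiset S) = {z, x}) ∨
      (a = z ∧ ({b, c} : Multiset S) = {x, y}) := by
  have ha : a ∈ ({x, y, z} : Multiset S) := h ▸ Multiset.mem_cons_self a _
  simp only [Multiset.insert_eq_cons, Multiset.mem_cons, Multiset.mem_singleton] at ha
  rcases ha with rfl | rfl | rfl
  · exact .inl ⟨rfl, (Multiset.cons_inj_right a).mp h⟩
  · refine .inr (.inl ⟨rfl, (Multiset.cons_inj_right a).mp (h.trans ?_)⟩)
    exact (Multiset.cons_swap ..).trans (congrArg _ (Multiset.pair_comm ..))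
  · refine .inr (.inr ⟨rfl, (Multiset.cons_inj_right a).mp (h.trans ?_)⟩)
    exact (congrArg _ (Multiset.pair_comm ..)).trans (Multiset.cons_swap ..)

variable {N : Submodule F (FreeNonUnitalNonAssocAlgebra F S)} {x y z : S}
  {φ : FreeNonUnitalNonAssocAlgebra F S}

theorem mem_of_vars_eq_singleton (hφ : ∀ w ∈ φ.coeff.support, vars w = {x}) (hx : of F x ∈ N) :
    φ ∈ N :=
  mem_of_forall_ofMagma_mem fun w hw => by
    have hvars := hφ w hw
    obtain ⟨a, rfl⟩ := exists_of_length_one (w := w) (by rw [← card_vars, hvars]; rfl)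
    obtain rfl := Multiset.singleton_inj.mp hvars
    exact hx

theorem mem_of_vars_eq_pair (hN : identities (SignedCom ε) S ≤ N)
    (hφ : ∀ w ∈ φ.coeff.support, vars w = {x, y}) (hxy : of F x * of F y ∈ N) : φ ∈ N :=
  mem_of_forall_ofMagma_mem fun w hw => by
    have hvars := hφ w hw
    obtain ⟨a, b, rfl⟩ := exists_of_length_two (w := w) (by rw [← card_vars, hvars]; rfl)
    rw [map_mul]
    rcases eq_or_swap_of_pair_eq hvars with ⟨rfl, rfl⟩ | ⟨rfl, rfl⟩
    · exact hxy
    · exact mul_mem_of_mul_swap_mem hN hxy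

theorem mem_of_vars_eq_triple (hN : identities (SignedCom ε) S ≤ N)
    (hφ : ∀ w ∈ φ.coeff.support, vars w = {x, y, z}) (hx : of F x * (of F y * of F z) ∈ N)
    (hy : of F y * (of F z * of F x) ∈ N) (hz : of F z * (of F x * of F y) ∈ N) : φ ∈ N := by
  have hpair {a b c d e : S} (h : ({b, c} : Multiset S) = {d, e})
      (hmem : of F a * (of F d * of F e) ∈ N) : of F a * (of F b * of F c) ∈ N := by
    rcases eq_or_swap_of_pair_eq h with ⟨rfl, rfl⟩ | ⟨rfl, rfl⟩
    · exact hmem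
    · exact mul_mul_mem_of_mul_mul_swap_mem hN hmem
  have hright {a b c : S} (h : ({a, b, c} : Multiset S) = {x, y, z}) :
      of F a * (of F b * of F c) ∈ N := by
    rcases eq_or_rotate_of_triple_eq h with ⟨rfl, hbc⟩ | ⟨rfl, hbc⟩ | ⟨rfl, hbc⟩
    · exact hpair hbc hx
    · exact hpair hbc hy
    · exact hpair hbc hz
  refine mem_of_forall_ofMagma_mem fun w hw => ?_
  have hvars := hφ w hw
  obtain ⟨a, b, c, rfl | rfl⟩ := exists_of_length_three (w := w) (by rw [← card_vars, hvars]; rfl)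
  · rw [map_mul, map_mul]
    exact hright hvars
  · rw [map_mul, map_mul]
    refine mul_mem_of_mul_swap_mem hN (hright (hvars ▸ ?_))
    exact add_comm ({c} : Multiset S) ({a} + {b})

end Multilinear

end Identities

/-! ### Cyclic relations -/

section CyclicRelations

variable {ε : F}

section CyclicForm

variable {A : Type*} [NonUnitalNonAssocRing A] [Module F A]

/-- The linear map that sends `(α, β, γ)` to `α a₀(a₁a₂) + β a₁(a₂a₀) + γ a₂(a₀a₁)`. -/
def cyclicForm (a : Fin 3 → A) : (Fin 3 → F) →ₗ[F] A :=
  Fintype.linearCombination F fun i => a i * (a (i + 1) * a (i + 2))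

theorem cyclicForm_apply (a : Fin 3 → A) (c : Fin 3 → F) :
    cyclicForm a c = ∑ i, c i • (a i * (a (i + 1) * a (i + 2))) :=
  Fintype.linearCombination_apply ..

theorem cyclicForm_vec (x y z : A) (c : Fin 3 → F) : cyclicForm ![x, y, z] c =
    c 0 • (x * (y * z)) + c 1 • (y * (z * x)) + c 2 • (z * (x * y)) := by
  rw [cyclicForm_apply, Fin.sum_univ_three]
  rfl

end CyclicForm

theorem map_cyclicForm {A B : Type*} [NonUnitalNonAssocRing A] [Module F A]
    [NonUnitalNonAssocRing B] [Module F B] (f : A →ₙₐ[F] B) (a : Fin 3 → A) (c : Fin 3 → F) :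
    f (cyclicForm a c) = cyclicForm (f ∘ a) c := by
  simp only [cyclicForm_apply, map_sum, map_smul, map_mul, Function.comp_apply]

/-- The coefficients `(α, β, γ)` such that `α x(yz) + β y(zx) + γ z(xy) = 0` holds in `A`. -/
def cyclicRelations (A : NAAlg F) : Submodule F (Fin 3 → F) :=
  ⨅ a : Fin 3 → A, LinearMap.ker (cyclicForm a)

theorem mem_cyclicRelations {A : NAAlg F} {c : Fin 3 → F} :
    c ∈ cyclicRelations A ↔ ∀ a : Fin 3 → A, cyclicForm a c = 0 := by
  simp only [cyclicRelations, Submodule.mem_iInf, LinearMap.mem_ker]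

theorem mem_cyclicRelations_iff_forall {A : NAAlg F} {c : Fin 3 → F} :
    c ∈ cyclicRelations A ↔ ∀ x y z : A,
      c 0 • (x * (y * z)) + c 1 • (y * (z * x)) + c 2 • (z * (x * y)) = 0 :=
  mem_cyclicRelations.trans
    ⟨fun h x y z => cyclicForm_vec x y z c ▸ h _, fun h a => by
      rw [cyclicForm_apply, Fin.sum_univ_three]
      exact h (a 0) (a 1) (a 2)⟩

/-- A transposition of the three arguments reverses their cyclic order. -/
theorem SignedCom.cyclicForm_comp_swap {A : NAAlg F} (hA : SignedCom ε A) (a : Fin 3 → A)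
    (c : Fin 3 → F) {i j : Fin 3} (hij : i ≠ j) :
    cyclicForm a (c ∘ Equiv.swap i j) = ε • cyclicForm (a ∘ Equiv.swap i j) c := by
  have hone : ∀ i j, i ≠ j → ∀ k : Fin 3, Equiv.swap i j (k + 1) = Equiv.swap i j k + 2 := by
    decide
  have htwo : ∀ i j, i ≠ j → ∀ k : Fin 3, Equiv.swap i j (k + 2) = Equiv.swap i j k + 1 := by
    decide
  rw [cyclicForm_apply, cyclicForm_apply, Finset.smul_sum, ← Equiv.sum_comp (Equiv.swap i j)]
  refine Finset.sum_congr rfl fun k _ => ?_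
  rw [Function.comp_apply, Equiv.swap_apply_self, Function.comp_apply, Function.comp_apply,
    Function.comp_apply, hone i j hij, htwo i j hij, hA (a (Equiv.swap i j k + 1)),
    mul_smul_comm, smul_comm]

theorem SignedCom.swapInvariant_cyclicRelations {A : NAAlg F} (hA : SignedCom ε A) :
    SwapInvariant (cyclicRelations A) := fun c hc i j => by
  rcases eq_or_ne i j with rfl | hij
  · rwa [Equiv.swap_self]
  · refine mem_cyclicRelations.mpr fun a => ?_
    rw [hA.cyclicForm_comp_swap a c hij, mem_cyclicRelations.mp hc, smul_zero]

theorem cyclicRelations_le_trunc (A : NAAlg F) : cyclicRelations A ≤ cyclicRelations (trunc A) := by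
  intro c hc
  rw [mem_cyclicRelations_iff_forall] at hc ⊢
  intro x y z
  apply trunc.coords.injective
  ext <;> simp [hc]

/-- The variety of algebras in which all `α x(yz) + β y(zx) + γ z(xy)` with `(α, β, γ)` in `W`
vanish. -/
def ofCyclicRelations (W : Submodule F (Fin 3 → F)) : ObjectProperty (NAAlg F) :=
  fun A => W ≤ cyclicRelations A

theorem ofCyclicRelations_bot : ofCyclicRelations (⊥ : Submodule F (Fin 3 → F)) = ⊤ :=
  funext fun _ => eq_true bot_le

theorem ofCyclicRelations_span_one :
    ofCyclicRelations (Submodule.span F {(1 : Fin 3 → F)}) = Jacobi F := by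
  funext A
  simp only [ofCyclicRelations, Submodule.span_singleton_le_iff_mem,
    mem_cyclicRelations_iff_forall, Pi.one_apply, one_smul, Jacobi]

/-- The algebras that satisfy `x * (y * z) = ε • ((x * y) * z)`. The cases `ε = 1` and `ε = -1` are
the associative and the anti-associative algebras. -/
def SignedAssoc (ε : F) : ObjectProperty (NAAlg F) :=
  fun A => ∀ x y z : A, x * (y * z) = ε • ((x * y) * z)

theorem signedAssoc_one : SignedAssoc (1 : F) = Assoc F := by
  funext A
  simp only [SignedAssoc, Assoc, one_smul]

theorem signedAssoc_neg_one : SignedAssoc (-1 : F) = AAssoc F := by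
  funext A
  simp only [SignedAssoc, AAssoc, neg_smul, one_smul]

theorem SignedCom.signedAssoc_iff (hε : ε * ε = 1) {A : NAAlg F} (hA : SignedCom ε A) :
    SignedAssoc ε A ↔ ∀ x y z : A, x * (y * z) = z * (x * y) := by
  refine forall_congr' fun x => forall_congr' fun y => forall_congr' fun z => ?_
  rw [hA (x * y) z, smul_smul, hε, one_smul]

theorem signedCom_inf_ofCyclicRelations_ker_sum (hε : ε * ε = 1) :
    SignedCom ε ⊓ ofCyclicRelations (LinearMap.ker
      (∑ k, LinearMap.proj k : (Fin 3 → F) →ₗ[F] F)) = SignedCom ε ⊓ SignedAssoc ε := by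
  ext A
  refine and_congr_right fun hA => ?_
  rw [hA.signedAssoc_iff hε]
  constructor
  · intro h x y z
    have hmem : ![1, 0, -1] ∈ cyclicRelations A := h (by simp [Fin.sum_univ_three])
    have heq := mem_cyclicRelations_iff_forall.mp hmem x y z
    simpa [← sub_eq_add_neg, sub_eq_zero] using heq
  · intro h c hc
    have hsum : c 0 + c 1 + c 2 = 0 := by simpa [Fin.sum_univ_three] using hc
    refine mem_cyclicRelations_iff_forall.mpr fun x y z => ?_
    rw [h x y z, h y z x, h x y z, ← add_smul, ← add_smul, hsum, zero_smul]

theorem signedCom_inf_ofCyclicRelations_top (ε : F) :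
    SignedCom ε ⊓ ofCyclicRelations ⊤ = Nil₂ (SignedCom ε) := by
  ext A
  refine and_congr_right fun hA => ⟨fun h => ?_, fun h c _ => ?_⟩
  · have hright (x y z : A) : x * (y * z) = 0 := by
      simpa using mem_cyclicRelations_iff_forall.mp (h (x := ![1, 0, 0]) trivial) x y z
    exact fun x y z => ⟨by rw [hA, hright, smul_zero], hright x y z⟩
  · exact mem_cyclicRelations_iff_forall.mpr fun x y z => by
      simp only [(h _ _ _).2, smul_zero, add_zero]

end CyclicRelations

/-! ### Quadratic operadic varieties -/

section Classification

variable {ε : F} {V : ObjectProperty (NAAlg F)}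

/-- The coefficients `(α, β, γ)` such that `α x(yz) + β y(zx) + γ z(xy) = 0` is an identity
of `V`. -/
def commonRelations (V : ObjectProperty (NAAlg F)) : Submodule F (Fin 3 → F) :=
  ⨅ A, ⨅ _ : V A, cyclicRelations A

theorem mem_commonRelations {c : Fin 3 → F} :
    c ∈ commonRelations V ↔ ∀ A, V A → c ∈ cyclicRelations A := by
  simp only [commonRelations, Submodule.mem_iInf]

theorem le_ofCyclicRelations_commonRelations : V ≤ ofCyclicRelations (commonRelations V) :=
  fun A hA _ hc => mem_commonRelations.mp hc A hA

theorem swapInvariant_commonRelations (hV : V ≤ SignedCom ε) :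
    SwapInvariant (commonRelations V) := fun c hc i j =>
  mem_commonRelations.mpr fun A hA =>
    (hV A hA).swapInvariant_cyclicRelations c (mem_commonRelations.mp hc A hA) i j

section FreeIdentities

variable {x y : S} {φ : FreeNonUnitalNonAssocAlgebra F S}

theorem of_notMem_identities (hV : AbAlg F ≤ V) (x : S) : of F x ∉ identities V S := fun h => by
  have hzero := h (abelian F F) (hV _ abelian_mul) fun _ => (abelian.equiv F F).symm 1
  rw [lift_of_apply] at hzero
  exact one_ne_zero ((abelian.equiv F F).symm.map_eq_zero_iff.mp hzero)

theorem le_abAlg_of_mul_mem_identities (hxy : x ≠ y) (h : of F x * of F y ∈ identities V S) :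
    V ≤ AbAlg F := fun A hA a b => by
  classical
  simpa [lift_of_apply, hxy.symm] using h A hA (Function.update (fun _ => b) x a)

theorem mem_commonRelations_of_cyclicForm_mem {x : Fin 3 → S} (hx : Function.Injective x)
    {c : Fin 3 → F} (h : cyclicForm (of F ∘ x) c ∈ identities V S) : c ∈ commonRelations V :=
  mem_commonRelations.mpr fun A hA => mem_cyclicRelations.mpr fun a => by
    have heval := h A hA (Function.extend x a 0)
    rw [map_cyclicForm, ← Function.comp_assoc, of_comp_lift, Function.extend_comp hx] at heval
    exact heval

theorem eq_zero_of_vars_eq_singleton (hV : AbAlg F ≤ V) (h : φ ∈ identities V S)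
    (hφ : ∀ w ∈ φ.coeff.support, vars w = {x}) : φ = 0 := by
  obtain ⟨c, rfl⟩ := Submodule.mem_span_singleton.mp
    (mem_of_vars_eq_singleton hφ (Submodule.mem_span_singleton_self (of F x)))
  by_contra hne
  have hc : c ≠ 0 := by
    rintro rfl
    exact hne (zero_smul ..)
  exact of_notMem_identities hV x (((identities V S).smul_mem_iff hc).mp h)

theorem mem_identities_signedCom_of_vars_eq_pair (hV : V ≤ SignedCom ε) (hVab : ¬ V ≤ AbAlg F)
    (hxy : x ≠ y) (h : φ ∈ identities V S) (hφ : ∀ w ∈ φ.coeff.support, vars w = {x, y}) :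
    φ ∈ identities (SignedCom ε) S := by
  have hmem : φ ∈ identities (SignedCom ε) S ⊔ Submodule.span F {of F x * of F y} :=
    mem_of_vars_eq_pair le_sup_left hφ
      (Submodule.mem_sup_right (Submodule.mem_span_singleton_self _))
  obtain ⟨ψ, hψ, _, hc, rfl⟩ := Submodule.mem_sup.mp hmem
  obtain ⟨c, rfl⟩ := Submodule.mem_span_singleton.mp hc
  have hcV : c • (of F x * of F y) ∈ identities V S :=
    ((identities V S).add_mem_iff_right (identities_anti hV hψ)).mp h
  obtain rfl : c = 0 := by
    by_contra hc0
    exact hVab (le_abAlg_of_mul_mem_identities hxy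
      (((identities V S).smul_mem_iff hc0).mp hcV))
  rwa [zero_smul, add_zero]

theorem mem_identities_of_vars_eq_triple (hV : V ≤ SignedCom ε) {x : Fin 3 → S}
    (hx : Function.Injective x) (h : φ ∈ identities V S)
    (hφ : ∀ w ∈ φ.coeff.support, vars w = {x 0, x 1, x 2}) :
    φ ∈ identities (SignedCom ε ⊓ ofCyclicRelations (commonRelations V)) S := by
  let N := identities (SignedCom ε) S ⊔ LinearMap.range (cyclicForm (F := F) (of F ∘ x))
  have hterm (i : Fin 3) : of F (x i) * (of F (x (i + 1)) * of F (x (i + 2))) ∈ N :=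
    Submodule.mem_sup_right ⟨Pi.single i 1, by simp [cyclicForm]⟩
  have hmem : φ ∈ N := mem_of_vars_eq_triple le_sup_left hφ (hterm 0) (hterm 1) (hterm 2)
  obtain ⟨ψ, hψ, _, ⟨c, rfl⟩, rfl⟩ := Submodule.mem_sup.mp hmem
  have hcV : cyclicForm (of F ∘ x) c ∈ identities V S :=
    ((identities V S).add_mem_iff_right (identities_anti hV hψ)).mp h
  have hc : c ∈ commonRelations V := mem_commonRelations_of_cyclicForm_mem hx hcV
  refine add_mem (identities_anti inf_le_left hψ) fun A hA v => ?_
  rw [map_cyclicForm]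
  exact mem_cyclicRelations.mp (hA.2 hc) _

end FreeIdentities

theorem satisfies_trunc_of_isMultilinear (hab : AbAlg F ≤ V) (hVab : ¬ V ≤ AbAlg F)
    (hV : V ≤ SignedCom ε) {A : NAAlg F} (hA : SignedCom ε A)
    (hrel : ofCyclicRelations (commonRelations V) A) {φ : FreeNonUnitalNonAssocAlgebra F S}
    (hφ : IsMultilinear φ) (h : φ ∈ identities V S) : Satisfies (trunc A) φ := by
  obtain ⟨s, hs⟩ := hφ
  have hlength (w) (hw : w ∈ φ.coeff.support) : w.length = s.card := by
    rw [← card_vars, hs w hw, Finset.card_def]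
  by_cases h1 : s.card = 1
  · obtain ⟨x, hx⟩ := Multiset.card_eq_one.mp h1
    rw [hx] at hs
    obtain rfl := eq_zero_of_vars_eq_singleton hab h hs
    exact fun v => map_zero (lift F v)
  by_cases h2 : s.card = 2
  · obtain ⟨x, y, hxy⟩ := Multiset.card_eq_two.mp h2
    have hne : x ≠ y := by simpa [hxy] using s.nodup
    rw [hxy] at hs
    exact mem_identities_signedCom_of_vars_eq_pair hV hVab hne h hs _ hA.trunc
  by_cases h3 : s.card = 3
  · obtain ⟨x, y, z, hxyz⟩ := Multiset.card_eq_three.mp h3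
    have hinj : Function.Injective ![x, y, z] := List.nodup_ofFn.mp (by
      simpa [hxyz] using s.nodup)
    rw [hxyz] at hs
    exact mem_identities_of_vars_eq_triple hV hinj h hs _
      ⟨hA.trunc, hrel.trans (cyclicRelations_le_trunc A)⟩
  · refine satisfies_trunc_of_three_lt_length fun w hw => ?_
    have := w.length_pos
    have := hlength w hw
    omega

theorem eq_signedCom_inf_ofCyclicRelations (operadic : IsOperadic V) (quadratic : IsQuadratic V)
    (hVab : V ≠ AbAlg F) (hV : V ≤ SignedCom ε) :
    V = SignedCom ε ⊓ ofCyclicRelations (commonRelations V) := by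
  have hab := abAlg_le_of_isQuadratic quadratic
  refine le_antisymm (le_inf hV le_ofCyclicRelations_commonRelations) fun A hA => ?_
  have htrunc : V (trunc A) := by
    obtain ⟨S, I, hI, hVI⟩ := operadic
    suffices ofIdentities I (trunc A) from hVI ▸ this
    exact fun φ hφ => satisfies_trunc_of_isMultilinear hab (fun h => hVab (h.antisymm hab)) hV
      hA.1 hA.2 (hI φ hφ) fun B hB => (hVI ▸ hB : ofIdentities I B) φ hφ
  obtain ⟨S, I, hI, rfl⟩ := quadratic
  exact fun φ hφ => satisfies_of_satisfies_trunc (hI φ hφ) (htrunc φ hφ)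

theorem eq_of_le_signedCom (operadic : IsOperadic V) (quadratic : IsQuadratic V)
    (hVab : V ≠ AbAlg F) (hε : ε * ε = 1) (hV : V ≤ SignedCom ε) :
    V = SignedCom ε ∨ V = SignedCom ε ⊓ Jacobi F ∨ V = SignedCom ε ⊓ SignedAssoc ε ∨
      V = Nil₂ (SignedCom ε) := by
  have heq := eq_signedCom_inf_ofCyclicRelations operadic quadratic hVab hV
  rcases (swapInvariant_commonRelations hV).eq_bot_or_eq_span_or_eq_ker_or_eq_top with
    hW | hW | hW | hW <;> rw [hW] at heq
  · exact .inl (by rwa [ofCyclicRelations_bot, inf_top_eq] at heq)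
  · exact .inr (.inl (by rwa [ofCyclicRelations_span_one] at heq))
  · exact .inr (.inr (.inl (by rwa [signedCom_inf_ofCyclicRelations_ker_sum hε] at heq)))
  · exact .inr (.inr (.inr (by rwa [signedCom_inf_ofCyclicRelations_top] at heq)))

theorem eq_of_actionAccessible_of_le_signedCom (operadic : IsOperadic V)
    (quadratic : IsQuadratic V) (accessible : ActionAccessible V.FullSubcategory)
    (hVab : V ≠ AbAlg F) (hε : ε * ε = 1) (hV : V ≤ SignedCom ε) :
    V = SignedCom ε ⊓ Jacobi F ∨ V = SignedCom ε ⊓ SignedAssoc ε ∨ V = Nil₂ (SignedCom ε) := by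
  refine (eq_of_le_signedCom operadic quadratic hVab hε hV).resolve_left ?_
  rintro rfl
  exact not_actionAccessible_signedCom hε accessible

end Classification

end NAVariety

theorem mainTheorem7 (F : Type u) [Field F] (V : ObjectProperty (NAAlg F))
    (operadic : NAVariety.IsOperadic V) (quadratic : NAVariety.IsQuadratic V)
    (accessible : ActionAccessible V.FullSubcategory)
    (nonabelian : V ≠ NAVariety.AbAlg F) :
    (V ≤ NAVariety.Com F →
      V = NAVariety.JJord F ∨ V = NAVariety.CAssoc F ∨
        V = NAVariety.JJord F ⊓ NAVariety.CAssoc F ∨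
        V = NAVariety.Nil₂ (NAVariety.Com F)) ∧
    (V ≤ NAVariety.ACom F →
      V = NAVariety.Lie F ∨ V = NAVariety.ACAAssoc F ∨
        V = NAVariety.Lie F ⊓ NAVariety.ACAAssoc F ∨
        V = NAVariety.Nil₂ (NAVariety.ACom F)) := by
  refine ⟨fun hV => ?_, fun hV => ?_⟩
  · rw [← NAVariety.signedCom_one] at hV
    have h := NAVariety.eq_of_actionAccessible_of_le_signedCom operadic quadratic accessible
      nonabelian (mul_one 1) hV
    rw [NAVariety.signedCom_one, NAVariety.signedAssoc_one] at h
    exact h.imp_right fun h => h.imp_right .inr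
  · rw [← NAVariety.signedCom_neg_one] at hV
    have h := NAVariety.eq_of_actionAccessible_of_le_signedCom operadic quadratic accessible
      nonabelian (by norm_num) hV
    rw [NAVariety.signedCom_neg_one, NAVariety.signedAssoc_neg_one] at h
    exact h.imp_right fun h => h.imp_right .inr
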